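/- \textbf{Setting.} Fix a countably infinite set $\mathsf{Prop}$ of propositional variables. Formulas of $\mathrm{BSML}$ are generated by $\phi ::= p \mid \bot \mid \mathrm{NE} \mid \neg\phi \mid (\phi\wedge\phi) \mid (\phi\vee\phi) \mid \Diamond\phi$ with $p\in\mathsf{Prop}$; $\mathrm{BSML}^{I}$ (BSMLI) additionally has a binary connective $\veebar $ (global disjunction). $\mathsf{P}(\phi)$ is the set of variables occurring in $\phi$. For $\mathsf{X}\subseteq\mathsf{Prop}$, a Kripke model over $\mathsf{X}$ is $M=(W,R,V)$ with $W\neq\emptyset$, $R\subseteq W\times W$, $V:\mathsf{X}\to\wp(W)$; a team on $M$ is a set $s\subseteq W$; $R[w]=\{v\mid wRv\}$. For $\mathsf{P}(\phi)\subseteq\mathsf{X}$, support $\vDash$ and anti-support $\dashv $ are defined by: \begin{itemize} \item $s\vDash p$ iff $w\in V(p)$ for all $w\in s$; $s\dashv p$ iff $w\notin V(p)$ for all $w\in s$; \item $s\vDash\bot$ iff $s=\emptyset$; $s\dashv \bot$ always; \item $s\vDash\mathrm{NE}$ iff $s\ne\emptyset$; $s\dashv \mathrm{NE}$ iff $s=\emptyset$;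 \item $s\vDash\neg\phi$ iff $s\dashv \phi$; $s\dashv \neg\phi$ iff $s\vDash\phi$; \item $s\vDash\phi\wedge\psi$ iff $s\vDash\phi$ and $s\vDash\psi$; $s\dashv \phi\wedge\psi$ iff $s=t\cup u$ for some $t\dashv \phi$, $u\dashv \psi$; \item $s\vDash\phi\vee\psi$ iff $s=t\cup u$ for some $t\vDash\phi$, $u\vDash\psi$; $s\dashv \phi\vee\psi$ iff $s\dashv \phi$ and $s\dashv \psi$; \item $s\vDash\phi\veebar \psi$ iff $s\vDash\phi$ or $s\vDash\psi$; $s\dashv \phi\veebar \psi$ iff $s\dashv \phi$ and $s\dashv \psi$; \item $s\vDash\Diamond\phi$ iff for every $w\in s$ there is a nonempty $t\subseteq R[w]$ with $t\vDash\phi$; $s\dashv \Diamond\phi$ iff $R[w]\dashv \phi$ for every $w\in s$. \end{itemize} A team property over $\mathsf{X}$ is a class of pairs $(M,s)$ with $M$ a model over $\mathsf{X}$ and $s$ a team on $M$; put $\|\phi\|_{\mathsf{X}}=\{(M,s)\text{ over }\mathsf{X}\mid M,s\vDash\phi\}$ for $\mathsf{P}(\phi)\subseteq\mathsf{X}$.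 A team property $\mathcal{P}$ over $\mathsf X$ is \emph{convex} if $(M,s),(M,t)\in\mathcal{P}$ and $t\subseteq u\subseteq s$ imply $(M,u)\in\mathcal{P}$; \emph{union closed} if $(M,\bigcup S)\in\mathcal{P}$ whenever $S\ne\emptyset$ is a set of teams on $M$ with $(M,s)\in\mathcal{P}$ for all $s\in S$; \emph{invariant under bounded bisimulation} if for some $k\in\mathbb{N}$, $(M,s)\in\mathcal{P}$ implies $(M',s')\in\mathcal{P}$ for all $(M',s')$ over $\mathsf{X}$ such that each $w\in s$ is $k$-bisimilar to some $w'\in s'$ and each $w'\in s'$ is $k$-bisimilar to some $w\in s$. Here $0$-bisimilar worlds are those that satisfy the same variables of $\mathsf{X}$, and $w,w'$ are $(k+1)$-bisimilar if they are $0$-bisimilar, each successor of $w$ is $k$-bisimilar to some successor of $w'$, and each successor of $w'$ is $k$-bisimilar to some successor of $w$. The \emph{ground team} of $\mathcal{P}$ is the class $\{(M,w)\mid w\in s\text{ for some }(M,s)\in\mathcal{P}\}$, and properties $\mathcal{P},\mathcal{Q}$ over $\mathsf{X}$ are \emph{ground-incompatible} if their ground teams are disjoint. For $L\in\{\mathrm{BSML},\mathrm{BSML}^{I}\}$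 let $\|L\|^{\pm}_{\mathsf{X}}=\{(\|\phi\|_{\mathsf{X}},\|\neg\phi\|_{\mathsf{X}})\mid\phi\in L,\ \mathsf{P}(\phi)\subseteq\mathsf{X}\}$. \textbf{Corollary (Bicompleteness of BSML and BSMLI).} For every finite $\mathsf{X}\subseteq\mathsf{Prop}$: \begin{enumerate} \item[(i)] $\|\mathrm{BSML}\|^{\pm}_{\mathsf{X}}$ is exactly the class of ground-incompatible pairs $(\mathcal{P},\mathcal{Q})$ of team properties over $\mathsf{X}$ such that both $\mathcal{P}$ and $\mathcal{Q}$ are convex, union closed, and invariant under bounded bisimulation. \item[(ii)] $\|\mathrm{BSML}^{I}\|^{\pm}_{\mathsf{X}}$ is exactly the class of ground-incompatible pairs $(\mathcal{P},\mathcal{Q})$ of team properties over $\mathsf{X}$ such that both $\mathcal{P}$ and $\mathcal{Q}$ are invariant under bounded bisimulation. \item[(iii)] Both logics are bicomplete modulo expressive power for ground-incompatible pairs: for each $L\in\{\mathrm{BSML},\mathrm{BSML}^{I}\}$, $\|L\|^{\pm}_{\mathsf{X}}$ is exactly the class of ground-incompatible pairs of the form $(\|\phi\|_{\mathsf{X}},\|\psi\|_{\mathsf{X}})$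 with $\phi,\psi\in L$ and $\mathsf{P}(\phi),\mathsf{P}(\psi)\subseteq\mathsf{X}$. \end{enumerate} -/

import Mathlib

universe u v

namespace TeamLogic

/-! ### Syntax -/

/-- Formulas of `BSMLI` over a set `Var` of propositional variables. -/
inductive Formula (Var : Type v) : Type v
  | atom (p : Var)
  | bot
  | ne
  | neg (φ : Formula Var)
  | conj (φ ψ : Formula Var)
  | disj (φ ψ : Formula Var)
  | gdisj (φ ψ : Formula Var)
  | dia (φ : Formula Var)

/-- The set of propositional variables occurring in a formula. -/
def Formula.vars {Var : Type v} : Formula Var → Set Var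
  | .atom p => {p}
  | .bot => ∅
  | .ne => ∅
  | .neg φ => φ.vars
  | .conj φ ψ => φ.vars ∪ ψ.vars
  | .disj φ ψ => φ.vars ∪ ψ.vars
  | .gdisj φ ψ => φ.vars ∪ ψ.vars
  | .dia φ => φ.vars

/-- The formula contains no occurrence of the global disjunction. -/
def Formula.GdisjFree {Var : Type v} : Formula Var → Prop
  | .atom _ => True
  | .bot => True
  | .ne => True
  | .neg φ => φ.GdisjFree
  | .conj φ ψ => φ.GdisjFree ∧ ψ.GdisjFree
  | .disj φ ψ => φ.GdisjFree ∧ ψ.GdisjFree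
  | .gdisj _ _ => False
  | .dia φ => φ.GdisjFree

/-- The language of `BSMLI`: all formulas. -/
def BSMLI (Var : Type v) : Set (Formula Var) := Set.univ

/-- The language of `BSML`: the formulas without global disjunction. -/
def BSML (Var : Type v) : Set (Formula Var) := {φ | φ.GdisjFree}

/-! ### Semantics -/

/-- Kripke models over a set `X` of propositional variables. -/
structure KripkeModel {Var : Type v} (X : Set Var) : Type (max (u + 1) v) where
  World : Type u
  nonempty : Nonempty World
  rel : World → World → Prop
  val : X → Set World

section Semantics

variable {Var : Type v} {X : Set Var}

/-- `R[w]`, the set of successors of `w`. -/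
def KripkeModel.succ (M : KripkeModel.{u} X) (w : M.World) : Set M.World :=
  {x | M.rel w x}

/-- Support (polarity `true`) and anti-support (polarity `false`) of a formula by a team. They
are used only for formulas whose variables lie in `X`; the clauses for a variable outside `X`
treat it as false everywhere, which is immaterial. -/
def KripkeModel.sat (M : KripkeModel.{u} X) : Bool → Formula Var → Set M.World → Prop
  | true, .atom p, s => ∀ w ∈ s, ∃ h : p ∈ X, w ∈ M.val ⟨p, h⟩
  | false, .atom p, s => ∀ w ∈ s, ¬ ∃ h : p ∈ X, w ∈ M.val ⟨p, h⟩
  | true, .bot, s => s = ∅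
  | false, .bot, _ => True
  | true, .ne, s => s ≠ ∅
  | false, .ne, s => s = ∅
  | true, .neg φ, s => M.sat false φ s
  | false, .neg φ, s => M.sat true φ s
  | true, .conj φ ψ, s => M.sat true φ s ∧ M.sat true ψ s
  | false, .conj φ ψ, s => ∃ t r, s = t ∪ r ∧ M.sat false φ t ∧ M.sat false ψ r
  | true, .disj φ ψ, s => ∃ t r, s = t ∪ r ∧ M.sat true φ t ∧ M.sat true ψ r
  | false, .disj φ ψ, s => M.sat false φ s ∧ M.sat false ψ s
  | true, .gdisj φ ψ, s => M.sat true φ s ∨ M.sat true ψ s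
  | false, .gdisj φ ψ, s => M.sat false φ s ∧ M.sat false ψ s
  | true, .dia φ, s => ∀ w ∈ s, ∃ t ⊆ M.succ w, t ≠ ∅ ∧ M.sat true φ t
  | false, .dia φ, s => ∀ w ∈ s, M.sat false φ (M.succ w)

/-- `M, s ⊨ φ`. -/
def KripkeModel.Supports (M : KripkeModel.{u} X) (s : Set M.World) (φ : Formula Var) : Prop :=
  M.sat true φ s

end Semantics

/-! ### Bounded bisimulation -/

section Bisimulation

variable {Var : Type v} {X : Set Var}

/-- `k`-bisimilarity of worlds with respect to `X`. -/
def KBisim (M N : KripkeModel.{u} X) : ℕ → M.World → N.World → Prop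
  | 0, w, x => ∀ p : X, w ∈ M.val p ↔ x ∈ N.val p
  | k + 1, w, x =>
      (∀ p : X, w ∈ M.val p ↔ x ∈ N.val p) ∧
      (∀ w' ∈ M.succ w, ∃ x' ∈ N.succ x, KBisim M N k w' x') ∧
      (∀ x' ∈ N.succ x, ∃ w' ∈ M.succ w, KBisim M N k w' x')

/-- `k`-bisimilarity of teams with respect to `X`. -/
def TeamKBisim (M N : KripkeModel.{u} X) (k : ℕ) (s : Set M.World) (t : Set N.World) : Prop :=
  (∀ w ∈ s, ∃ x ∈ t, KBisim M N k w x) ∧ (∀ x ∈ t, ∃ w ∈ s, KBisim M N k w x)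

end Bisimulation

/-! ### Properties -/

/-- Pointed models over `X`. -/
structure PointedModel {Var : Type v} (X : Set Var) : Type (max (u + 1) v) where
  model : KripkeModel.{u} X
  world : model.World

/-- Pointed team models over `X`. -/
structure TeamModel {Var : Type v} (X : Set Var) : Type (max (u + 1) v) where
  model : KripkeModel.{u} X
  team : Set model.World

/-- World properties over `X`: classes of pointed models. -/
abbrev WorldProperty {Var : Type v} (X : Set Var) : Type (max (u + 1) v) :=
  Set (PointedModel.{u} X)

/-- Team properties over `X`: classes of pointed team models. -/
abbrev TeamProperty {Var : Type v} (X : Set Var) : Type (max (u + 1) v) :=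
  Set (TeamModel.{u} X)

section Properties

variable {Var : Type v} {X : Set Var}

/-- `‖φ‖_X`, the team property over `X` expressed by `φ`. -/
def expressed (X : Set Var) (φ : Formula Var) : TeamProperty.{u} X :=
  {A | A.model.Supports A.team φ}

/-- The ground team of a team property. -/
def groundTeam (P : TeamProperty.{u} X) : WorldProperty.{u} X :=
  {A | ∃ s : Set A.model.World, (⟨A.model, s⟩ : TeamModel.{u} X) ∈ P ∧ A.world ∈ s}

/-- Two team properties are ground-incompatible if their ground teams are disjoint. -/
def GroundIncompatible (P Q : TeamProperty.{u} X) : Prop :=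
  groundTeam P ∩ groundTeam Q = ∅

/-- Convexity of a team property. -/
def IsConvex (P : TeamProperty.{u} X) : Prop :=
  ∀ (M : KripkeModel.{u} X) (s t r : Set M.World),
    (⟨M, s⟩ : TeamModel.{u} X) ∈ P → (⟨M, t⟩ : TeamModel.{u} X) ∈ P → t ⊆ r → r ⊆ s →
      (⟨M, r⟩ : TeamModel.{u} X) ∈ P

/-- Closure under unions of nonempty families of teams. -/
def IsUnionClosed (P : TeamProperty.{u} X) : Prop :=
  ∀ (M : KripkeModel.{u} X) (S : Set (Set M.World)), S.Nonempty →
    (∀ s ∈ S, (⟨M, s⟩ : TeamModel.{u} X) ∈ P) → (⟨M, ⋃₀ S⟩ : TeamModel.{u} X) ∈ P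

/-- Invariance under `k`-bisimulation for some `k`. -/
def IsBoundedBisimInvariant (P : TeamProperty.{u} X) : Prop :=
  ∃ k : ℕ, ∀ (M N : KripkeModel.{u} X) (s : Set M.World) (t : Set N.World),
    (⟨M, s⟩ : TeamModel.{u} X) ∈ P → TeamKBisim M N k s t → (⟨N, t⟩ : TeamModel.{u} X) ∈ P

end Properties

/-! ### Bicompleteness -/

/-- Pair properties, given for each `X` by the pairs of team properties over `X` they contain. -/
abbrev PairProperty (Var : Type v) : Type (max (u + 1) v) :=
  ∀ X : Set Var, Set (TeamProperty.{u} X × TeamProperty.{u} X)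

section Bicompleteness

variable {Var : Type v}

/-- The pairs `(‖φ‖_X, ‖¬φ‖_X)` for formulas `φ` of `L` with variables in `X`. -/
def negationPairs (L : Set (Formula Var)) : PairProperty.{u} Var :=
  fun X => {A | ∃ φ ∈ L, φ.vars ⊆ X ∧ A = (expressed X φ, expressed X φ.neg)}

/-- The pairs `(‖φ‖_X, ‖ψ‖_X)` for formulas `φ`, `ψ` of `L` with variables in `X`. -/
def expressiblePairs (L : Set (Formula Var)) : PairProperty.{u} Var :=
  fun X => {A | ∃ φ ∈ L, ∃ ψ ∈ L, φ.vars ⊆ X ∧ ψ.vars ⊆ X ∧ A = (expressed X φ, expressed X ψ)}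

/-- `L` is bicomplete for the pair property `C`. -/
def Bicomplete (L : Set (Formula Var)) (C : PairProperty.{u} Var) : Prop :=
  ∀ X : Set Var, X.Finite → negationPairs.{u} L X = C X

/-- `L` is bicomplete modulo expressive power for the pair property `C`. -/
def BicompleteModuloExpressivePower (L : Set (Formula Var)) (C : PairProperty.{u} Var) : Prop :=
  Bicomplete L (fun X => C X ∩ expressiblePairs.{u} L X)

/-- The ground-incompatible pairs. -/
def groundIncompatiblePairs (Var : Type v) : PairProperty.{u} Var :=
  fun _ => {A | GroundIncompatible A.1 A.2}

/-- The ground-incompatible pairs of properties invariant under bounded bisimulation. -/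
def invariantPairs (Var : Type v) : PairProperty.{u} Var :=
  fun _ => {A | (IsBoundedBisimInvariant A.1 ∧ IsBoundedBisimInvariant A.2) ∧
    GroundIncompatible A.1 A.2}

/-- The ground-incompatible pairs of convex and union-closed properties invariant under bounded
bisimulation. -/
def convexUnionClosedInvariantPairs (Var : Type v) : PairProperty.{u} Var :=
  fun _ => {A | (IsConvex A.1 ∧ IsUnionClosed A.1 ∧ IsBoundedBisimInvariant A.1) ∧
    (IsConvex A.2 ∧ IsUnionClosed A.2 ∧ IsBoundedBisimInvariant A.2) ∧
    GroundIncompatible A.1 A.2}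

end Bicompleteness

end TeamLogic

namespace TeamLogic

variable {Var : Type v} {X : Set Var}

/-! ### Bisimulation types -/

/-! Over a finite `X` there are finitely many `k`-types of worlds, and an invariant property is
determined by the sets of `k`-types of its teams (`IsBisimInvariant.image_mem_typeSets`). For each
such property P one builds a formula φ supported exactly by the teams in P and, crucially,
anti-supported exactly by the teams sharing no type with any team in P. With global disjunction, φ
lists the admissible sets of types (`exists_formula`). Without it, convexity and union closure say
that a set of types is admissible iff it consists of types occurring in P and includes an admissible
set (`mem_typeSets_of_subset`), which a conjunction of nonemptiness demands can state
(`exists_gdisjFree_formula`).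

Given such φ for P and ψ for Q, the pair is expressed by φ ∨ (¬ψ ∧ ε), where ε is supported and
anti-supported by the empty team only. The second disjunct adds nothing to support; anti-support
amounts to anti-supporting φ and supporting ψ, and the former is redundant because
ground-incompatible properties have disjoint sets of types (`disjoint_sUnion_typeSets`).

Conversely, inductions on formulas, treating support and anti-support together, give invariance,
disjointness of supporting from anti-supporting teams and, without global disjunction, convexity and
union closure. -/

theorem KBisim.val {M N : KripkeModel.{u} X} {k : ℕ} {w : M.World} {x : N.World}
    (h : KBisim M N k w x) (p : X) : w ∈ M.val p ↔ x ∈ N.val p := by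
  cases k with
  | zero => exact h p
  | succ k => exact h.1 p

theorem KBisim.of_succ {M N : KripkeModel.{u} X} {k : ℕ} {w : M.World} {x : N.World}
    (h : KBisim M N (k + 1) w x) : KBisim M N k w x := by
  induction k generalizing w x with
  | zero => exact h.1
  | succ k ih =>
    refine ⟨h.1, fun w' hw' => ?_, fun x' hx' => ?_⟩
    · obtain ⟨x', hx', hb⟩ := h.2.1 w' hw'
      exact ⟨x', hx', ih hb⟩
    · obtain ⟨w', hw', hb⟩ := h.2.2 x' hx'
      exact ⟨w', hw', ih hb⟩

theorem KBisim.mono {M N : KripkeModel.{u} X} {j k : ℕ} (hjk : j ≤ k) {w : M.World}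
    {x : N.World} (h : KBisim M N k w x) : KBisim M N j w x := by
  induction hjk with
  | refl => exact h
  | step _ ih => exact ih h.of_succ

theorem TeamKBisim.mono {M N : KripkeModel.{u} X} {j k : ℕ} (hjk : j ≤ k) {s : Set M.World}
    {t : Set N.World} (h : TeamKBisim M N k s t) : TeamKBisim M N j s t :=
  ⟨fun w hw => let ⟨x, hx, hb⟩ := h.1 w hw; ⟨x, hx, hb.mono hjk⟩,
    fun x hx => let ⟨w, hw, hb⟩ := h.2 x hx; ⟨w, hw, hb.mono hjk⟩⟩

theorem TeamKBisim.eq_empty {M N : KripkeModel.{u} X} {k : ℕ} {s : Set M.World}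
    {t : Set N.World} (h : TeamKBisim M N k s t) (hs : s = ∅) : t = ∅ := by
  subst hs
  refine Set.eq_empty_of_forall_notMem fun x hx => ?_
  obtain ⟨w, hw, -⟩ := h.2 x hx
  exact hw

/-- A splitting of a team can be transferred along a team bisimulation. -/
theorem TeamKBisim.exists_union {M N : KripkeModel.{u} X} {k : ℕ} {s₁ s₂ : Set M.World}
    {t : Set N.World} (h : TeamKBisim M N k (s₁ ∪ s₂) t) :
    ∃ t₁ t₂, t = t₁ ∪ t₂ ∧ TeamKBisim M N k s₁ t₁ ∧ TeamKBisim M N k s₂ t₂ := by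
  refine ⟨{x ∈ t | ∃ w ∈ s₁, KBisim M N k w x}, {x ∈ t | ∃ w ∈ s₂, KBisim M N k w x}, ?_,
    ⟨fun w hw => ?_, fun x hx => hx.2⟩, ⟨fun w hw => ?_, fun x hx => hx.2⟩⟩
  · ext x
    constructor
    · intro hx
      obtain ⟨w, hw | hw, hb⟩ := h.2 x hx
      · exact Or.inl ⟨hx, w, hw, hb⟩
      · exact Or.inr ⟨hx, w, hw, hb⟩
    · rintro (hx | hx) <;> exact hx.1
  · obtain ⟨x, hx, hb⟩ := h.1 w (Or.inl hw)
    exact ⟨x, ⟨hx, w, hw, hb⟩, hb⟩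
  · obtain ⟨x, hx, hb⟩ := h.1 w (Or.inr hw)
    exact ⟨x, ⟨hx, w, hw, hb⟩, hb⟩

/-- The `k`-types of worlds of models over `X`. -/
def BisimType (X : Set Var) : ℕ → Type v
  | 0 => Set X
  | k + 1 => Set X × Set (BisimType X k)

/-- This finiteness is what allows conjunctions and disjunctions over types, or over sets of types,
to be formulas. -/
theorem BisimType.finite (hX : X.Finite) (k : ℕ) : Finite (BisimType X k) := by
  have := hX.to_subtype
  induction k with
  | zero => exact inferInstanceAs (Finite (Set X))
  | succ k ih => exact inferInstanceAs (Finite (Set X × Set (BisimType X k)))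

/-- The `k`-type of a world. -/
def KripkeModel.bisimType (M : KripkeModel.{u} X) : ∀ k : ℕ, M.World → BisimType X k
  | 0, w => ({p | w ∈ M.val p} : Set X)
  | k + 1, w => (({p | w ∈ M.val p} : Set X), M.bisimType k '' M.succ w)

theorem image_eq_image_iff {α β γ : Type*} {f : α → γ} {g : β → γ} {s : Set α} {t : Set β} :
    f '' s = g '' t ↔ (∀ a ∈ s, ∃ b ∈ t, f a = g b) ∧ ∀ b ∈ t, ∃ a ∈ s, f a = g b := by
  refine Set.Subset.antisymm_iff.trans (and_congr ?_ Set.image_subset_iff)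
  refine Set.image_subset_iff.trans ?_
  exact forall₂_congr fun _ _ => exists_congr fun _ => and_congr_right fun _ => eq_comm

/-- The back-and-forth conditions on successors say precisely that the two successor sets have the
same image of `k`-types. -/
theorem kBisim_iff_bisimType_eq {M N : KripkeModel.{u} X} {k : ℕ} {w : M.World} {x : N.World} :
    KBisim M N k w x ↔ M.bisimType k w = N.bisimType k x := by
  induction k generalizing w x with
  | zero => exact (Set.ext_iff (a := {p | w ∈ M.val p}) (b := {p | x ∈ N.val p})).symm
  | succ k ih =>
    refine Iff.trans ?_ (Prod.ext_iff (x := (({p | w ∈ M.val p} : Set X), M.bisimType k '' M.succ w))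
      (y := (({p | x ∈ N.val p} : Set X), N.bisimType k '' N.succ x))).symm
    refine and_congr (Set.ext_iff (a := {p | w ∈ M.val p}) (b := {p | x ∈ N.val p})).symm ?_
    simp only [ih]
    exact image_eq_image_iff.symm

theorem teamKBisim_iff_image_eq {M N : KripkeModel.{u} X} {k : ℕ} {s : Set M.World}
    {t : Set N.World} :
    TeamKBisim M N k s t ↔ M.bisimType k '' s = N.bisimType k '' t := by
  simp only [TeamKBisim, kBisim_iff_bisimType_eq]
  exact image_eq_image_iff.symm

/-! ### Closure properties of formulas -/

/-- Support and anti-support of every formula are preserved by sufficiently deep bisimulations. -/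
theorem exists_sat_of_teamKBisim (φ : Formula Var) :
    ∃ k : ℕ, ∀ (b : Bool) (M N : KripkeModel.{u} X) (s : Set M.World) (t : Set N.World),
      TeamKBisim M N k s t → M.sat b φ s → N.sat b φ t := by
  induction φ with
  | atom p =>
    refine ⟨0, fun b M N s t h hs => ?_⟩
    cases b
    · intro x hx ⟨hp, hv⟩
      obtain ⟨w, hw, hb⟩ := h.2 x hx
      exact hs w hw ⟨hp, (hb.val _).2 hv⟩
    · intro x hx
      obtain ⟨w, hw, hb⟩ := h.2 x hx
      obtain ⟨hp, hv⟩ := hs w hw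
      exact ⟨hp, (hb.val _).1 hv⟩
  | bot =>
    refine ⟨0, fun b M N s t h hs => ?_⟩
    cases b
    · trivial
    · exact h.eq_empty hs
  | ne =>
    refine ⟨0, fun b M N s t h hs => ?_⟩
    cases b
    · exact h.eq_empty hs
    · obtain ⟨w, hw⟩ := Set.nonempty_iff_ne_empty.2 hs
      obtain ⟨x, hx, -⟩ := h.1 w hw
      exact Set.nonempty_iff_ne_empty.1 ⟨x, hx⟩
  | neg φ ih =>
    obtain ⟨k, ih⟩ := ih
    refine ⟨k, fun b M N s t h hs => ?_⟩
    cases b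
    · exact ih true M N s t h hs
    · exact ih false M N s t h hs
  | conj φ ψ ih₁ ih₂ =>
    obtain ⟨k₁, ih₁⟩ := ih₁
    obtain ⟨k₂, ih₂⟩ := ih₂
    refine ⟨max k₁ k₂, fun b M N s t h hs => ?_⟩
    cases b
    · obtain ⟨s₁, s₂, rfl, h₁, h₂⟩ := hs
      obtain ⟨t₁, t₂, rfl, hb₁, hb₂⟩ := h.exists_union
      exact ⟨t₁, t₂, rfl, ih₁ _ _ _ _ _ (hb₁.mono (le_max_left _ _)) h₁,
        ih₂ _ _ _ _ _ (hb₂.mono (le_max_right _ _)) h₂⟩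
    · exact ⟨ih₁ _ _ _ _ _ (h.mono (le_max_left _ _)) hs.1,
        ih₂ _ _ _ _ _ (h.mono (le_max_right _ _)) hs.2⟩
  | disj φ ψ ih₁ ih₂ =>
    obtain ⟨k₁, ih₁⟩ := ih₁
    obtain ⟨k₂, ih₂⟩ := ih₂
    refine ⟨max k₁ k₂, fun b M N s t h hs => ?_⟩
    cases b
    · exact ⟨ih₁ _ _ _ _ _ (h.mono (le_max_left _ _)) hs.1,
        ih₂ _ _ _ _ _ (h.mono (le_max_right _ _)) hs.2⟩
    · obtain ⟨s₁, s₂, rfl, h₁, h₂⟩ := hs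
      obtain ⟨t₁, t₂, rfl, hb₁, hb₂⟩ := h.exists_union
      exact ⟨t₁, t₂, rfl, ih₁ _ _ _ _ _ (hb₁.mono (le_max_left _ _)) h₁,
        ih₂ _ _ _ _ _ (hb₂.mono (le_max_right _ _)) h₂⟩
  | gdisj φ ψ ih₁ ih₂ =>
    obtain ⟨k₁, ih₁⟩ := ih₁
    obtain ⟨k₂, ih₂⟩ := ih₂
    refine ⟨max k₁ k₂, fun b M N s t h hs => ?_⟩
    cases b
    · exact ⟨ih₁ _ _ _ _ _ (h.mono (le_max_left _ _)) hs.1,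
        ih₂ _ _ _ _ _ (h.mono (le_max_right _ _)) hs.2⟩
    · exact Or.imp (ih₁ _ _ _ _ _ (h.mono (le_max_left _ _)))
        (ih₂ _ _ _ _ _ (h.mono (le_max_right _ _))) hs
  | dia φ ih =>
    obtain ⟨k, ih⟩ := ih
    refine ⟨k + 1, fun b M N s t h hs => ?_⟩
    cases b
    · intro x hx
      obtain ⟨w, hw, hb⟩ := h.2 x hx
      exact ih false M N _ _ hb.2 (hs w hw)
    · intro x hx
      obtain ⟨w, hw, hb⟩ := h.2 x hx
      obtain ⟨r, hr, hne, hsat⟩ := hs w hw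
      -- The witness `r` is one part of the successor set, so the splitting lemma yields its
      -- counterpart among the successors of `x`.
      have hb' : TeamKBisim M N k (r ∪ M.succ w) (N.succ x) := by
        rw [Set.union_eq_self_of_subset_left hr]
        exact hb.2
      obtain ⟨t₁, t₂, ht, hb₁, -⟩ := hb'.exists_union
      refine ⟨t₁, ht ▸ Set.subset_union_left, ?_, ih true M N _ _ hb₁ hsat⟩
      obtain ⟨v, hv⟩ := Set.nonempty_iff_ne_empty.2 hne
      obtain ⟨y, hy, -⟩ := hb₁.1 v hv
      exact Set.nonempty_iff_ne_empty.1 ⟨y, hy⟩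

theorem isBoundedBisimInvariant_expressed (φ : Formula Var) :
    IsBoundedBisimInvariant (expressed.{u} X φ) := by
  obtain ⟨k, hk⟩ := exists_sat_of_teamKBisim.{u} (X := X) φ
  exact ⟨k, fun M N s t hs hb => hk true M N s t hb hs⟩

/-- A supporting team and an anti-supporting team of the same formula are disjoint. -/
theorem disjoint_of_sat (M : KripkeModel.{u} X) (φ : Formula Var) {s t : Set M.World}
    (hs : M.sat true φ s) (ht : M.sat false φ t) {w : M.World} (hws : w ∈ s) : w ∉ t := by
  intro hwt
  induction φ generalizing s t w with
  | atom p => exact ht w hwt (hs w hws)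
  | bot => exact absurd hws (Set.eq_empty_iff_forall_notMem.1 hs w)
  | ne => exact absurd hwt (Set.eq_empty_iff_forall_notMem.1 ht w)
  | neg φ ih => exact ih ht hs hwt hws
  | conj φ ψ ih₁ ih₂ =>
    obtain ⟨t₁, t₂, rfl, h₁, h₂⟩ := ht
    rcases hwt with hw | hw
    · exact ih₁ hs.1 h₁ hws hw
    · exact ih₂ hs.2 h₂ hws hw
  | disj φ ψ ih₁ ih₂ =>
    obtain ⟨s₁, s₂, rfl, h₁, h₂⟩ := hs
    rcases hws with hw | hw
    · exact ih₁ h₁ ht.1 hw hwt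
    · exact ih₂ h₂ ht.2 hw hwt
  | gdisj φ ψ ih₁ ih₂ =>
    rcases hs with h | h
    · exact ih₁ h ht.1 hws hwt
    · exact ih₂ h ht.2 hws hwt
  | dia φ ih =>
    -- Nonemptiness of the witness is essential: it supplies a successor lying in both a supporting
    -- and an anti-supporting team of `φ`.
    obtain ⟨r, hr, hne, hsat⟩ := hs w hws
    obtain ⟨v, hv⟩ := Set.nonempty_iff_ne_empty.2 hne
    exact ih hsat (ht w hwt) hv (hr hv)

theorem groundIncompatible_expressed_neg (φ : Formula Var) :
    GroundIncompatible (expressed.{u} X φ) (expressed.{u} X φ.neg) := by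
  refine Set.eq_empty_of_forall_notMem ?_
  rintro ⟨M, w⟩ ⟨⟨s, hs, hws⟩, t, ht, hwt⟩
  exact disjoint_of_sat M φ hs ht hws hwt

/-! ### Convex and union-closed families of sets -/

section SetFamilies

variable {α : Type*}

/-- A family of sets that is convex and closed under unions of nonempty subfamilies. -/
structure ConvexUnionClosed (F : Set (Set α)) : Prop where
  convex : ∀ ⦃s t r⦄, s ∈ F → t ∈ F → t ⊆ r → r ⊆ s → r ∈ F
  sUnion : ∀ ⦃S : Set (Set α)⦄, S.Nonempty → S ⊆ F → ⋃₀ S ∈ F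

theorem ConvexUnionClosed.union {F : Set (Set α)} (hF : ConvexUnionClosed F) {s t : Set α}
    (hs : s ∈ F) (ht : t ∈ F) : s ∪ t ∈ F := by
  rw [← Set.sUnion_pair]
  refine hF.sUnion ⟨s, by simp⟩ ?_
  rintro r (rfl | rfl) <;> assumption

theorem ConvexUnionClosed.inter {F G : Set (Set α)} (hF : ConvexUnionClosed F)
    (hG : ConvexUnionClosed G) : ConvexUnionClosed (F ∩ G) where
  convex _ _ _ hs ht htr hrs := ⟨hF.convex hs.1 ht.1 htr hrs, hG.convex hs.2 ht.2 htr hrs⟩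
  sUnion _ hne hS := ⟨hF.sUnion hne fun _ h => (hS h).1, hG.sUnion hne fun _ h => (hS h).2⟩

theorem convexUnionClosed_powerset (A : Set α) : ConvexUnionClosed {s | s ⊆ A} where
  convex _ _ _ hs _ _ hrs := hrs.trans hs
  sUnion _ _ hS := Set.sUnion_subset hS

/-- Convexity of the split family needs union closure of `F` and `G` as well: the parts of the large
set must be enlarged by the parts of the small one before being cut down. -/
theorem ConvexUnionClosed.tensor {F G : Set (Set α)} (hF : ConvexUnionClosed F)
    (hG : ConvexUnionClosed G) :
    ConvexUnionClosed {s | ∃ t r, s = t ∪ r ∧ t ∈ F ∧ r ∈ G} where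
  convex := by
    rintro _ _ r ⟨t₁, r₁, rfl, ht₁, hr₁⟩ ⟨t₂, r₂, rfl, ht₂, hr₂⟩ hsub hsup
    -- The first part lies between `t₂` and `t₁ ∪ t₂`, both in `F`; likewise the second in `G`.
    refine ⟨(t₁ ∩ r) ∪ t₂, (r₁ ∩ r) ∪ r₂, ?_,
      hF.convex (hF.union ht₁ ht₂) ht₂ Set.subset_union_right
        (Set.union_subset_union_left _ Set.inter_subset_left),
      hG.convex (hG.union hr₁ hr₂) hr₂ Set.subset_union_right
        (Set.union_subset_union_left _ Set.inter_subset_left)⟩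
    ext x
    have h₁ := @hsub x
    have h₂ := @hsup x
    simp only [Set.mem_union, Set.mem_inter_iff] at h₁ h₂ ⊢
    tauto
  sUnion := by
    rintro S ⟨s₀, hs₀⟩ hS
    refine ⟨⋃₀ {t ∈ F | ∃ r ∈ G, t ∪ r ∈ S}, ⋃₀ {r ∈ G | ∃ t ∈ F, t ∪ r ∈ S}, ?_,
      hF.sUnion ?_ fun _ h => h.1, hG.sUnion ?_ fun _ h => h.1⟩
    · ext x
      constructor
      · rintro ⟨s, hs, hx⟩
        obtain ⟨t, r, rfl, ht, hr⟩ := hS hs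
        rcases hx with hx | hx
        · exact Or.inl ⟨t, ⟨ht, r, hr, hs⟩, hx⟩
        · exact Or.inr ⟨r, ⟨hr, t, ht, hs⟩, hx⟩
      · rintro (⟨t, ⟨-, r, -, hs⟩, hx⟩ | ⟨r, ⟨-, t, -, hs⟩, hx⟩)
        · exact ⟨_, hs, Or.inl hx⟩
        · exact ⟨_, hs, Or.inr hx⟩
    · obtain ⟨t, r, rfl, ht, hr⟩ := hS hs₀
      exact ⟨t, ht, r, hr, hs₀⟩
    · obtain ⟨t, r, rfl, ht, hr⟩ := hS hs₀
      exact ⟨r, hr, t, ht, hs₀⟩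

end SetFamilies

/-- Variables and diamonds are tested world by world, so at either polarity their teams form a
powerset; the remaining clauses are intersections, splittings or immediate. -/
theorem Formula.GdisjFree.convexUnionClosed {φ : Formula Var} (hφ : φ.GdisjFree)
    (M : KripkeModel.{u} X) (b : Bool) : ConvexUnionClosed {s | M.sat b φ s} := by
  induction φ generalizing b with
  | atom p => cases b <;> exact convexUnionClosed_powerset {w | _}
  | bot =>
    cases b
    · exact ⟨fun _ _ _ _ _ _ _ => trivial, fun _ _ _ => trivial⟩
    · simpa only [KripkeModel.sat, Set.subset_empty_iff] using
        convexUnionClosed_powerset (∅ : Set M.World)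
  | ne =>
    cases b
    · simpa only [KripkeModel.sat, Set.subset_empty_iff] using
        convexUnionClosed_powerset (∅ : Set M.World)
    · simp only [KripkeModel.sat, ← Set.nonempty_iff_ne_empty]
      exact ⟨fun _ _ _ _ ht htr _ => Set.Nonempty.mono htr ht, fun S hne hS =>
        let ⟨s, hs⟩ := hne; Set.Nonempty.mono (Set.subset_sUnion_of_mem hs) (hS hs)⟩
  | neg φ ih => cases b <;> exact ih hφ _
  | conj φ ψ ih₁ ih₂ =>
    cases b
    · exact (ih₁ hφ.1 false).tensor (ih₂ hφ.2 false)
    · exact (ih₁ hφ.1 true).inter (ih₂ hφ.2 true)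
  | disj φ ψ ih₁ ih₂ =>
    cases b
    · exact (ih₁ hφ.1 false).inter (ih₂ hφ.2 false)
    · exact (ih₁ hφ.1 true).tensor (ih₂ hφ.2 true)
  | gdisj φ ψ => exact hφ.elim
  | dia φ => cases b <;> exact convexUnionClosed_powerset {w | _}

theorem Formula.GdisjFree.isConvex_expressed {φ : Formula Var} (hφ : φ.GdisjFree) :
    IsConvex (expressed.{u} X φ) :=
  fun M _ _ _ hs ht htr hrs => (hφ.convexUnionClosed M true).convex hs ht htr hrs

theorem Formula.GdisjFree.isUnionClosed_expressed {φ : Formula Var} (hφ : φ.GdisjFree) :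
    IsUnionClosed (expressed.{u} X φ) :=
  fun M _ hne hS => (hφ.convexUnionClosed M true).sUnion hne hS

/-! ### Flat definability -/

/-- A world property is flatly definable if some formula without global disjunction is supported
exactly by the teams inside it and anti-supported exactly by the teams avoiding it. -/
def FlatDefinable (D : ∀ M : KripkeModel.{u} X, Set M.World) : Prop :=
  ∃ φ : Formula Var, φ.GdisjFree ∧ φ.vars ⊆ X ∧ ∀ (M : KripkeModel.{u} X) (s : Set M.World),
    (M.sat true φ s ↔ s ⊆ D M) ∧ (M.sat false φ s ↔ s ⊆ (D M)ᶜ)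

namespace FlatDefinable

variable {D E : ∀ M : KripkeModel.{u} X, Set M.World}

theorem val (p : X) : FlatDefinable.{u} (fun M : KripkeModel.{u} X => M.val p) := by
  refine ⟨.atom p, trivial, Set.singleton_subset_iff.2 p.2, fun M s => ⟨?_, ?_⟩⟩
  · exact forall₂_congr fun w _ => exists_prop_of_true p.2
  · exact forall₂_congr fun w _ => not_congr (exists_prop_of_true p.2)

theorem univ : FlatDefinable.{u} (fun _ : KripkeModel.{u} X => Set.univ) :=
  ⟨.neg .bot, trivial, Set.empty_subset _, fun M s => by simp [KripkeModel.sat]⟩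

theorem compl (h : FlatDefinable D) : FlatDefinable fun M => (D M)ᶜ := by
  obtain ⟨φ, hg, hv, hφ⟩ := h
  exact ⟨.neg φ, hg, hv, fun M s => ⟨(hφ M s).2, by rw [compl_compl]; exact (hφ M s).1⟩⟩

theorem inter (h : FlatDefinable D) (h' : FlatDefinable E) :
    FlatDefinable fun M => D M ∩ E M := by
  obtain ⟨φ, hg, hv, hφ⟩ := h
  obtain ⟨ψ, hg', hv', hψ⟩ := h'
  refine ⟨.conj φ ψ, ⟨hg, hg'⟩, Set.union_subset hv hv', fun M s => ⟨?_, ?_⟩⟩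
  · simp only [KripkeModel.sat, hφ, hψ, Set.subset_inter_iff]
  · simp only [KripkeModel.sat, hφ, hψ, Set.compl_inter]
    constructor
    · rintro ⟨t, r, rfl, ht, hr⟩
      exact Set.union_subset_union ht hr
    · intro hs
      refine ⟨s ∩ (D M)ᶜ, s ∩ (E M)ᶜ, ?_, Set.inter_subset_right, Set.inter_subset_right⟩
      rw [← Set.inter_union_distrib_left, Set.inter_eq_left.2 hs]

theorem dia (h : FlatDefinable D) :
    FlatDefinable fun M => {w | (M.succ w ∩ D M).Nonempty} := by
  obtain ⟨φ, hg, hv, hφ⟩ := h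
  refine ⟨.dia φ, hg, hv, fun M s => ⟨?_, ?_⟩⟩
  · simp only [KripkeModel.sat, hφ]
    refine forall₂_congr fun w _ => ⟨?_, ?_⟩
    · rintro ⟨t, ht, hne, hD⟩
      exact (Set.nonempty_iff_ne_empty.2 hne).mono (Set.subset_inter ht hD)
    · intro hne
      exact ⟨_, Set.inter_subset_left, Set.nonempty_iff_ne_empty.1 hne, Set.inter_subset_right⟩
  · simp only [KripkeModel.sat, hφ]
    refine forall₂_congr fun w _ => ?_
    rw [Set.subset_compl_iff_disjoint_right, Set.disjoint_iff_inter_eq_empty,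
      Set.mem_compl_iff, Set.mem_ofPred_eq, Set.not_nonempty_iff_eq_empty]

theorem iInter {ι : Type*} [Finite ι] {D : ι → ∀ M : KripkeModel.{u} X, Set M.World}
    (h : ∀ i, FlatDefinable (D i)) : FlatDefinable fun M => ⋂ i, D i M := by
  classical
  have := Fintype.ofFinite ι
  have key : ∀ F : Finset ι, FlatDefinable fun M => ⋂ i ∈ F, D i M := by
    intro F
    induction F using Finset.induction_on with
    | empty => simpa using univ
    | insert i F _ ih => simpa only [Finset.set_biInter_insert] using (h i).inter ih
  simpa using key Finset.univ

theorem iUnion {ι : Type*} [Finite ι] {D : ι → ∀ M : KripkeModel.{u} X, Set M.World}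
    (h : ∀ i, FlatDefinable (D i)) : FlatDefinable fun M => ⋃ i, D i M := by
  simpa only [Set.compl_iInter, compl_compl] using (iInter fun i => (h i).compl).compl

/-- If each of finitely many world properties is definable, so is any prescription of which of
them hold. -/
theorem setOf_eq {ι : Type*} [Finite ι] {D : ι → ∀ M : KripkeModel.{u} X, Set M.World}
    (h : ∀ i, FlatDefinable (D i)) (a : Set ι) :
    FlatDefinable fun M => {w | {i | w ∈ D i M} = a} := by
  classical
  have key : FlatDefinable fun M => ⋂ i, (if i ∈ a then D i else fun M => (D i M)ᶜ) M := by
    refine iInter fun i => ?_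
    split_ifs
    · exact h i
    · exact (h i).compl
  convert key using 3 with M
  ext w
  simp only [Set.mem_ofPred_eq, Set.mem_iInter, Set.ext_iff]
  refine forall_congr' fun i => ?_
  by_cases hi : i ∈ a <;> simp [hi]

/-- These are the characteristic (Hintikka) formulas: a `(k + 1)`-type prescribes which variables
hold and for which `k`-types a successor of that type exists. -/
theorem bisimType_eq (hX : X.Finite) (k : ℕ) (τ : BisimType X k) :
    FlatDefinable.{u} fun M : KripkeModel.{u} X => {w | M.bisimType k w = τ} := by
  have := hX.to_subtype
  induction k with
  | zero => exact setOf_eq val τ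
  | succ k ih =>
    have := BisimType.finite hX k
    convert (setOf_eq val τ.1).inter (setOf_eq (fun σ => (ih σ).dia) τ.2) using 3 with M
    ext w
    refine (Prod.ext_iff (x := (({p | w ∈ M.val p} : Set X), M.bisimType k '' M.succ w))
      (y := τ)).trans ?_
    exact Iff.rfl

theorem bisimType_mem (hX : X.Finite) {k : ℕ} (C : Set (BisimType X k)) :
    FlatDefinable.{u} fun M : KripkeModel.{u} X => M.bisimType k ⁻¹' C := by
  have := BisimType.finite hX k
  convert iUnion (fun τ : C => bisimType_eq hX k τ.1) using 3 with M
  ext w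
  simp

end FlatDefinable

/-! ### Formulas for sets of types -/

section Types

variable {k : ℕ}

/-- For every set `A` of types and every family `𝒞` of sets of types there is a formula stating
that all types of the team lie in `A` and that some of them lie in each member of `𝒞`; it is
anti-supported by the teams whose types avoid `A`. -/
theorem exists_formula_subset_inter (hX : X.Finite) (A : Set (BisimType X k))
    (𝒞 : Set (Set (BisimType X k))) :
    ∃ φ : Formula Var, φ.GdisjFree ∧ φ.vars ⊆ X ∧
      ∀ (M : KripkeModel.{u} X) (s : Set M.World),
        (M.sat true φ s ↔ M.bisimType k '' s ⊆ A ∧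
          ∀ C ∈ 𝒞, (M.bisimType k '' s ∩ C).Nonempty) ∧
        (M.sat false φ s ↔ Disjoint (M.bisimType k '' s) A) := by
  have := BisimType.finite hX k
  induction 𝒞, Set.toFinite 𝒞 using Set.Finite.induction_on with
  | empty =>
    obtain ⟨φ, hg, hv, hφ⟩ := FlatDefinable.bisimType_mem.{u} hX A
    refine ⟨φ, hg, hv, fun M s => ⟨?_, ?_⟩⟩
    · simp [(hφ M s).1]
    · rw [(hφ M s).2, ← Set.preimage_compl, ← Set.image_subset_iff,
        Set.subset_compl_iff_disjoint_right]
  | @insert C 𝒞 _ _ ih =>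
    obtain ⟨φ, hg, hv, hφ⟩ := ih
    obtain ⟨χ, hg', hv', hχ⟩ := FlatDefinable.bisimType_mem.{u} hX C
    -- The new conjunct (χ ∧ NE) ∨ ⊤ demands a nonempty subteam with types in `C`. Only the empty
    -- team anti-supports it, since only the empty team anti-supports ⊤, so the anti-support
    -- condition of `φ` is unchanged.
    refine ⟨.conj φ (.disj (.conj χ .ne) (.neg .bot)), ⟨hg, ⟨hg', trivial⟩, trivial⟩, ?_,
      fun M s => ⟨?_, ?_⟩⟩
    · simp [Formula.vars, hv, hv']
    · have h : M.sat true (.disj (.conj χ .ne) (.neg .bot)) s ↔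
          (M.bisimType k '' s ∩ C).Nonempty := by
        simp only [KripkeModel.sat, hχ]
        constructor
        · rintro ⟨t, r, rfl, ⟨ht, hne⟩, -⟩
          obtain ⟨w, hw⟩ := Set.nonempty_iff_ne_empty.2 hne
          exact ⟨_, ⟨w, Or.inl hw, rfl⟩, ht hw⟩
        · rintro ⟨_, ⟨w, hw, rfl⟩, hC⟩
          exact ⟨{w}, s, by simp [hw], ⟨by simpa using hC, Set.singleton_ne_empty w⟩, trivial⟩
      rw [Set.forall_mem_insert, and_left_comm, ← h, ← (hφ M s).1, and_comm]
      rfl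
    · rw [← (hφ M s).2]
      constructor
      · rintro ⟨t, r, rfl, ht, -, rfl⟩
        rwa [Set.union_empty]
      · intro hs
        refine ⟨s, ∅, (Set.union_empty s).symm, hs, ⟨∅, ∅, (Set.union_empty ∅).symm, ?_, rfl⟩, rfl⟩
        exact (hχ M ∅).2.2 (Set.empty_subset _)

/-- The sets of `k`-types of the teams of a property. -/
def typeSets (k : ℕ) (P : TeamProperty.{u} X) : Set (Set (BisimType X k)) :=
  {a | ∃ A ∈ P, A.model.bisimType k '' A.team = a}

/-- Invariance of a property under `k`-bisimulation. -/
def IsBisimInvariant (k : ℕ) (P : TeamProperty.{u} X) : Prop :=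
  ∀ (M N : KripkeModel.{u} X) (s : Set M.World) (t : Set N.World),
    (⟨M, s⟩ : TeamModel.{u} X) ∈ P → TeamKBisim M N k s t → (⟨N, t⟩ : TeamModel.{u} X) ∈ P

theorem IsBisimInvariant.image_mem_typeSets {P : TeamProperty.{u} X}
    (hP : IsBisimInvariant k P) {M : KripkeModel.{u} X} {s : Set M.World} :
    M.bisimType k '' s ∈ typeSets k P ↔ (⟨M, s⟩ : TeamModel.{u} X) ∈ P := by
  constructor
  · rintro ⟨⟨N, t⟩, ht, h⟩
    exact hP _ _ _ _ ht (teamKBisim_iff_image_eq.2 h)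
  · exact fun h => ⟨_, h, rfl⟩

theorem IsBisimInvariant.mono {P : TeamProperty.{u} X} {j : ℕ} (hP : IsBisimInvariant j P)
    (hjk : j ≤ k) : IsBisimInvariant k P :=
  fun _ _ _ _ hs h => hP _ _ _ _ hs (h.mono hjk)

/-- The disjoint union of a family of models. -/
def KripkeModel.sigma {ι : Type} [Nonempty ι] (M : ι → KripkeModel.{u} X) :
    KripkeModel.{u} X where
  World := Σ i, (M i).World
  nonempty := let ⟨i⟩ := ‹Nonempty ι›; let ⟨w⟩ := (M i).nonempty; ⟨⟨i, w⟩⟩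
  rel x y := ∃ v, (M x.1).rel x.2 v ∧ y = ⟨x.1, v⟩
  val p := {x | x.2 ∈ (M x.1).val p}

theorem kBisim_sigma {ι : Type} [Nonempty ι] (M : ι → KripkeModel.{u} X) (k : ℕ) (i : ι)
    (w : (M i).World) : KBisim (M i) (.sigma M) k w ⟨i, w⟩ := by
  induction k generalizing w with
  | zero => exact fun p => Iff.rfl
  | succ k ih =>
    refine ⟨fun p => Iff.rfl, fun w' hw' => ⟨⟨i, w'⟩, ⟨w', hw', rfl⟩, ih w'⟩, ?_⟩
    rintro _ ⟨w', hw', rfl⟩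
    exact ⟨w', hw', ih w'⟩

theorem teamKBisim_sigma {ι : Type} [Nonempty ι] (M : ι → KripkeModel.{u} X) (k : ℕ) (i : ι)
    (s : Set (M i).World) :
    TeamKBisim (M i) (.sigma M) k s ((fun w => ⟨i, w⟩ : _ → (Σ i, (M i).World)) '' s) := by
  refine ⟨fun w hw => ⟨_, ⟨w, hw, rfl⟩, kBisim_sigma M k i w⟩, ?_⟩
  rintro _ ⟨w, hw, rfl⟩
  exact ⟨w, hw, kBisim_sigma M k i w⟩

/-- A family of team models is realized, up to `k`-bisimilarity, in a single model. -/
theorem exists_common_model {ι : Type} [Nonempty ι] (k : ℕ) (T : ι → TeamModel.{u} X) :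
    ∃ (N : KripkeModel.{u} X) (t : ι → Set N.World),
      ∀ i, TeamKBisim (T i).model N k (T i).team (t i) :=
  ⟨.sigma fun i => (T i).model, _, fun i => teamKBisim_sigma (fun i => (T i).model) k i _⟩

/-- Ground-incompatibility concerns worlds of one model, while a shared type may be realized in two
unrelated ones. Bringing both teams into a common model and exchanging worlds of equal type turns a
shared type into a shared world. -/
theorem disjoint_sUnion_typeSets {P Q : TeamProperty.{u} X} (hP : IsBisimInvariant k P)
    (hQ : IsBisimInvariant k Q) (h : GroundIncompatible P Q) :
    Disjoint (⋃₀ typeSets k P) (⋃₀ typeSets k Q) := by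
  rw [Set.disjoint_left]
  rintro τ ⟨_, ⟨A, hA, rfl⟩, hτA⟩ ⟨_, ⟨B, hB, rfl⟩, hτB⟩
  obtain ⟨N, t, ht⟩ := exists_common_model k fun b : Bool => if b then A else B
  have h₁ : TeamKBisim A.model N k A.team (t true) := ht true
  have h₂ : TeamKBisim B.model N k B.team (t false) := ht false
  have hPt := hP _ _ _ _ hA h₁
  have hQt := hQ _ _ _ _ hB h₂
  rw [teamKBisim_iff_image_eq.1 h₁] at hτA
  rw [teamKBisim_iff_image_eq.1 h₂] at hτB
  obtain ⟨x, hx, rfl⟩ := hτA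
  -- Adding `x` leaves the set of types of the Q-team unchanged, as its type already occurs there.
  have hQx : (⟨N, insert x (t false)⟩ : TeamModel.{u} X) ∈ Q := by
    rw [← hQ.image_mem_typeSets, Set.image_insert_eq, Set.insert_eq_of_mem hτB]
    exact hQ.image_mem_typeSets.2 hQt
  have hmem : (⟨N, x⟩ : PointedModel.{u} X) ∈ groundTeam P ∩ groundTeam Q :=
    ⟨⟨_, hPt, hx⟩, _, hQx, Set.mem_insert _ _⟩
  rw [h] at hmem
  exact hmem

/-- The type sets of a convex and union-closed property are closed under enlargement by types
that occur in the property. -/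
theorem mem_typeSets_of_subset (hX : X.Finite) {P : TeamProperty.{u} X}
    (hP : IsBisimInvariant k P) (hconv : IsConvex P) (hunion : IsUnionClosed P)
    {m a : Set (BisimType X k)} (hm : m ∈ typeSets k P) (hma : m ⊆ a)
    (ha : a ⊆ ⋃₀ typeSets k P) : a ∈ typeSets k P := by
  have := BisimType.finite hX k
  -- Indexing by `Fin n` keeps the worlds of the disjoint union of the chosen teams' models in
  -- universe `u`.
  obtain ⟨n, ⟨e⟩⟩ := Finite.exists_equiv_fin (typeSets k P)
  have : Nonempty (Fin n) := ⟨e ⟨m, hm⟩⟩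
  choose T hTP hT using fun i : Fin n => (e.symm i).2
  obtain ⟨N, t, ht⟩ := exists_common_model k T
  have htP : ∀ i, (⟨N, t i⟩ : TeamModel.{u} X) ∈ P := fun i => hP _ _ _ _ (hTP i) (ht i)
  have himg : ∀ b (hb : b ∈ typeSets k P), N.bisimType k '' t (e ⟨b, hb⟩) = b := fun b hb => by
    rw [← teamKBisim_iff_image_eq.1 (ht _), hT, Equiv.symm_apply_apply]
  have hU : (⟨N, ⋃ i, t i⟩ : TeamModel.{u} X) ∈ P :=
    hunion N (Set.range t) (Set.range_nonempty t) (Set.forall_mem_range.2 htP)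
  -- The union of all chosen teams realizes every type occurring in `P`. Restricting it to the types
  -- in `a` keeps the team chosen for `m`, so convexity applies.
  have hr : (⟨N, (⋃ i, t i) ∩ N.bisimType k ⁻¹' a⟩ : TeamModel.{u} X) ∈ P := by
    refine hconv N _ _ _ hU (htP (e ⟨m, hm⟩)) ?_ Set.inter_subset_left
    refine Set.subset_inter (Set.subset_iUnion t _) ?_
    rw [← Set.image_subset_iff, himg]
    exact hma
  rw [← hP.image_mem_typeSets, Set.image_inter_preimage, Set.inter_eq_right.2] at hr
  · exact hr
  · intro τ hτ
    obtain ⟨b, hb, hτb⟩ := ha hτ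
    rw [← himg b hb] at hτb
    exact Set.image_mono (Set.subset_iUnion t _) hτb

/-- Every convex, union-closed and invariant property is expressed by a formula without global
disjunction that is anti-supported by the teams with no type occurring in the property. -/
theorem exists_gdisjFree_formula (hX : X.Finite) {P : TeamProperty.{u} X}
    (hP : IsBisimInvariant k P) (hconv : IsConvex P) (hunion : IsUnionClosed P) :
    ∃ φ : Formula Var, φ.GdisjFree ∧ φ.vars ⊆ X ∧
      ∀ (M : KripkeModel.{u} X) (s : Set M.World),
        (M.sat true φ s ↔ (⟨M, s⟩ : TeamModel.{u} X) ∈ P) ∧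
        (M.sat false φ s ↔ Disjoint (M.bisimType k '' s) (⋃₀ typeSets k P)) := by
  -- The demands range over all sets meeting every member of `typeSets k P`. If `P` is empty, the
  -- empty set is among them and no team satisfies the demands.
  obtain ⟨φ, hg, hv, hφ⟩ := exists_formula_subset_inter.{u} hX (⋃₀ typeSets k P)
    {C | ∀ m ∈ typeSets k P, (m ∩ C).Nonempty}
  refine ⟨φ, hg, hv, fun M s => ⟨?_, (hφ M s).2⟩⟩
  rw [(hφ M s).1, ← hP.image_mem_typeSets]
  constructor
  · rintro ⟨hsub, hC⟩
    by_contra hs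
    -- If no admissible set were included in the team's set of types, the complement of that set
    -- would meet every admissible set, so the team would have a type outside its own set of types.
    obtain ⟨τ, hτ, hτ'⟩ := hC (M.bisimType k '' s)ᶜ fun m hm =>
      Set.inter_compl_nonempty_iff.2 fun hms =>
        hs (mem_typeSets_of_subset hX hP hconv hunion hm hms hsub)
    exact hτ' hτ
  · exact fun hs => ⟨Set.subset_sUnion_of_mem hs, fun C hC => hC _ hs⟩

/-- Every family of sets of types is expressed by a formula that is anti-supported by the teams
with no type in a member of the family. -/
theorem exists_formula_image_mem (hX : X.Finite) (F : Set (Set (BisimType X k))) :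
    ∃ φ : Formula Var, φ.vars ⊆ X ∧
      ∀ (M : KripkeModel.{u} X) (s : Set M.World),
        (M.sat true φ s ↔ M.bisimType k '' s ∈ F) ∧
        (M.sat false φ s ↔ Disjoint (M.bisimType k '' s) (⋃₀ F)) := by
  have := BisimType.finite hX k
  induction F, Set.toFinite F using Set.Finite.induction_on with
  | empty =>
    -- ⊥ ∧ NE is supported by no team, not even the empty one, and anti-supported by all.
    refine ⟨.conj .bot .ne, by simp [Formula.vars], fun M s => ⟨?_, ?_⟩⟩
    · exact iff_of_false (fun h => h.2 h.1) (Set.notMem_empty _)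
    · exact iff_of_true ⟨s, ∅, (Set.union_empty s).symm, trivial, rfl⟩ (by simp)
  | @insert a F _ _ ih =>
    obtain ⟨φ, hv, hφ⟩ := ih
    -- Demanding every singleton of `a` forces the team's set of types to be all of `a`.
    obtain ⟨θ, -, hv', hθ⟩ := exists_formula_subset_inter.{u} hX a {C | ∃ τ ∈ a, C = {τ}}
    refine ⟨.gdisj θ φ, Set.union_subset hv' hv, fun M s => ⟨?_, ?_⟩⟩
    · refine (or_congr ((hθ M s).1.trans ?_) (hφ M s).1).trans Set.mem_insert_iff.symm
      refine Iff.trans (and_congr_right fun _ => ?_) Set.Subset.antisymm_iff.symm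
      constructor
      · intro h τ hτ
        obtain ⟨_, hσ, rfl⟩ := h {τ} ⟨τ, hτ, rfl⟩
        exact hσ
      · rintro h _ ⟨τ, hτ, rfl⟩
        exact ⟨τ, h hτ, rfl⟩
    · rw [Set.sUnion_insert, Set.disjoint_union_right]
      exact and_congr (hθ M s).2 (hφ M s).2

/-- Every invariant property is expressed by a formula that is anti-supported by the teams with
no type occurring in the property. -/
theorem exists_formula (hX : X.Finite) {P : TeamProperty.{u} X} (hP : IsBisimInvariant k P) :
    ∃ φ : Formula Var, φ.vars ⊆ X ∧
      ∀ (M : KripkeModel.{u} X) (s : Set M.World),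
        (M.sat true φ s ↔ (⟨M, s⟩ : TeamModel.{u} X) ∈ P) ∧
        (M.sat false φ s ↔ Disjoint (M.bisimType k '' s) (⋃₀ typeSets k P)) := by
  obtain ⟨φ, hv, hφ⟩ := exists_formula_image_mem.{u} hX (typeSets k P)
  exact ⟨φ, hv, fun M s => ⟨(hφ M s).1.trans hP.image_mem_typeSets, (hφ M s).2⟩⟩

end Types

/-! ### Bicompleteness -/

/-- A formula supported, and anti-supported, by the empty team only. -/
def Formula.onlyEmpty : Formula Var := .dia (.conj (.neg (.conj .bot .ne)) .bot)

/-- The formula under the diamond is supported by the empty team alone, which the diamond does not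
accept as a witness, and anti-supported by no team. At both polarities the diamond can therefore
hold only vacuously. -/
theorem KripkeModel.sat_onlyEmpty (M : KripkeModel.{u} X) (b : Bool) (s : Set M.World) :
    M.sat b .onlyEmpty s ↔ s = ∅ := by
  constructor
  · refine fun h => Set.eq_empty_of_forall_notMem fun w hw => ?_
    cases b
    · obtain ⟨_, _, -, ⟨h₁, h₂⟩, -⟩ := h w hw
      exact h₂ h₁
    · obtain ⟨t, -, hne, -, ht⟩ := h w hw
      exact hne ht
  · rintro rfl
    cases b <;> exact fun _ h => h.elim

/-- A formula that combines the support conditions of two formulas into its support and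
anti-support conditions. -/
def Formula.combine (φ ψ : Formula Var) : Formula Var := .disj φ (.conj (.neg ψ) .onlyEmpty)

theorem Formula.vars_combine_subset {φ ψ : Formula Var} (hφ : φ.vars ⊆ X) (hψ : ψ.vars ⊆ X) :
    (φ.combine ψ).vars ⊆ X := by
  simp [combine, onlyEmpty, vars, hφ, hψ]

theorem Formula.GdisjFree.combine {φ ψ : Formula Var} (hφ : φ.GdisjFree) (hψ : ψ.GdisjFree) :
    (φ.combine ψ).GdisjFree := by
  simp [Formula.combine, Formula.onlyEmpty, GdisjFree, hφ, hψ]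

theorem KripkeModel.sat_true_combine {M : KripkeModel.{u} X} {φ ψ : Formula Var}
    (hψ : M.sat false ψ ∅) (s : Set M.World) : M.sat true (φ.combine ψ) s ↔ M.sat true φ s := by
  constructor
  · rintro ⟨t, r, rfl, ht, -, hr⟩
    rw [(M.sat_onlyEmpty true r).1 hr, Set.union_empty]
    exact ht
  · exact fun hs =>
      ⟨s, ∅, (Set.union_empty s).symm, hs, hψ, (M.sat_onlyEmpty true ∅).2 rfl⟩

/-- Anti-support of the second disjunct splits the team into one supporting `ψ` and an empty one;
the hypothesis makes the anti-support of `φ` automatic. -/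
theorem KripkeModel.sat_false_combine {M : KripkeModel.{u} X} {φ ψ : Formula Var}
    {s : Set M.World} (h : M.sat true ψ s → M.sat false φ s) :
    M.sat false (φ.combine ψ) s ↔ M.sat true ψ s := by
  constructor
  · rintro ⟨-, t, r, rfl, ht, hr⟩
    rw [(M.sat_onlyEmpty false r).1 hr, Set.union_empty]
    exact ht
  · exact fun hs => ⟨h hs, s, ∅, (Set.union_empty s).symm, hs, (M.sat_onlyEmpty false ∅).2 rfl⟩

theorem eq_expressed_combine {k : ℕ} {P Q : TeamProperty.{u} X} (hP : IsBisimInvariant k P)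
    (hQ : IsBisimInvariant k Q) (hPQ : GroundIncompatible P Q) {φ ψ : Formula Var}
    (hφ : ∀ (M : KripkeModel.{u} X) (s : Set M.World),
      (M.sat true φ s ↔ (⟨M, s⟩ : TeamModel.{u} X) ∈ P) ∧
      (M.sat false φ s ↔ Disjoint (M.bisimType k '' s) (⋃₀ typeSets k P)))
    (hψ : ∀ (M : KripkeModel.{u} X) (s : Set M.World),
      (M.sat true ψ s ↔ (⟨M, s⟩ : TeamModel.{u} X) ∈ Q) ∧
      (M.sat false ψ s ↔ Disjoint (M.bisimType k '' s) (⋃₀ typeSets k Q))) :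
    (P, Q) = (expressed X (φ.combine ψ), expressed X (φ.combine ψ).neg) := by
  refine Prod.ext (Set.ext fun A => ?_) (Set.ext fun A => ?_)
  · refine ((KripkeModel.sat_true_combine ?_ _).trans (hφ A.model A.team).1).symm
    rw [(hψ _ _).2, Set.image_empty]
    exact Set.empty_disjoint _
  · refine ((KripkeModel.sat_false_combine fun h => ?_).trans (hψ A.model A.team).1).symm
    -- This is where ground-incompatibility is used: the types of a team in `Q` avoid all types
    -- occurring in `P`, so the team anti-supports `φ`.
    rw [(hψ _ _).1, ← hQ.image_mem_typeSets] at h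
    rw [(hφ _ _).2]
    exact (disjoint_sUnion_typeSets hP hQ hPQ).symm.mono_left (Set.subset_sUnion_of_mem h)

theorem bicomplete_BSML :
    Bicomplete (BSML Var) (convexUnionClosedInvariantPairs.{u} Var) := by
  intro X hX
  refine Set.Subset.antisymm ?_ ?_
  · rintro _ ⟨φ, hφ, -, rfl⟩
    have hneg : φ.neg.GdisjFree := hφ
    exact ⟨⟨Formula.GdisjFree.isConvex_expressed hφ, Formula.GdisjFree.isUnionClosed_expressed hφ,
        isBoundedBisimInvariant_expressed φ⟩,
      ⟨hneg.isConvex_expressed, hneg.isUnionClosed_expressed,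
        isBoundedBisimInvariant_expressed φ.neg⟩, groundIncompatible_expressed_neg φ⟩
  · rintro ⟨P, Q⟩ ⟨⟨hPc, hPu, k₁, hP⟩, ⟨hQc, hQu, k₂, hQ⟩, hPQ⟩
    -- Both properties are described by types of one common depth, so that their types can be
    -- compared.
    replace hP := IsBisimInvariant.mono hP (le_max_left k₁ k₂)
    replace hQ := IsBisimInvariant.mono hQ (le_max_right k₁ k₂)
    obtain ⟨φ, hgφ, hvφ, hφ⟩ := exists_gdisjFree_formula hX hP hPc hPu
    obtain ⟨ψ, hgψ, hvψ, hψ⟩ := exists_gdisjFree_formula hX hQ hQc hQu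
    exact ⟨φ.combine ψ, hgφ.combine hgψ, Formula.vars_combine_subset hvφ hvψ,
      eq_expressed_combine hP hQ hPQ hφ hψ⟩

theorem bicomplete_BSMLI : Bicomplete (BSMLI Var) (invariantPairs.{u} Var) := by
  intro X hX
  refine Set.Subset.antisymm ?_ ?_
  · rintro _ ⟨φ, -, -, rfl⟩
    exact ⟨⟨isBoundedBisimInvariant_expressed φ, isBoundedBisimInvariant_expressed φ.neg⟩,
      groundIncompatible_expressed_neg φ⟩
  · rintro ⟨P, Q⟩ ⟨⟨⟨k₁, hP⟩, k₂, hQ⟩, hPQ⟩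
    replace hP := IsBisimInvariant.mono hP (le_max_left k₁ k₂)
    replace hQ := IsBisimInvariant.mono hQ (le_max_right k₁ k₂)
    obtain ⟨φ, hvφ, hφ⟩ := exists_formula hX hP
    obtain ⟨ψ, hvψ, hψ⟩ := exists_formula hX hQ
    exact ⟨φ.combine ψ, trivial, Formula.vars_combine_subset hvφ hvψ,
      eq_expressed_combine hP hQ hPQ hφ hψ⟩

/-- Closure of the language under negation makes the second component of a negation pair
expressible. The reverse inclusion follows from bicompleteness, since expressible properties have
the required closure properties. -/
theorem negationPairs_subset {L : Set (Formula Var)} (hL : ∀ φ ∈ L, φ.neg ∈ L) (X : Set Var) :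
    negationPairs.{u} L X ⊆ groundIncompatiblePairs Var X ∩ expressiblePairs L X := by
  rintro _ ⟨φ, hφ, hv, rfl⟩
  exact ⟨groundIncompatible_expressed_neg φ, φ, hφ, φ.neg, hL φ hφ, hv, hv, rfl⟩

theorem bicompleteModuloExpressivePower_BSML :
    BicompleteModuloExpressivePower (BSML Var) (groundIncompatiblePairs.{u} Var) := by
  intro X hX
  refine (negationPairs_subset (fun _ h => h) X).antisymm ?_
  rintro _ ⟨hPQ, φ, hφ, ψ, hψ, -, -, rfl⟩
  rw [bicomplete_BSML X hX]
  exact ⟨⟨Formula.GdisjFree.isConvex_expressed hφ, Formula.GdisjFree.isUnionClosed_expressed hφ,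
      isBoundedBisimInvariant_expressed φ⟩,
    ⟨Formula.GdisjFree.isConvex_expressed hψ, Formula.GdisjFree.isUnionClosed_expressed hψ,
      isBoundedBisimInvariant_expressed ψ⟩, hPQ⟩

theorem bicompleteModuloExpressivePower_BSMLI :
    BicompleteModuloExpressivePower (BSMLI Var) (groundIncompatiblePairs.{u} Var) := by
  intro X hX
  refine (negationPairs_subset (L := BSMLI Var) (fun _ _ => trivial) X).antisymm ?_
  rintro _ ⟨hPQ, φ, -, ψ, -, -, -, rfl⟩
  rw [bicomplete_BSMLI X hX]
  exact ⟨⟨isBoundedBisimInvariant_expressed φ, isBoundedBisimInvariant_expressed ψ⟩, hPQ⟩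

end TeamLogic

theorem mainTheorem3 (Var : Type v) [Countable Var] [Infinite Var] :
    TeamLogic.Bicomplete (TeamLogic.BSML Var)
        (TeamLogic.convexUnionClosedInvariantPairs.{u} Var) ∧
      TeamLogic.Bicomplete (TeamLogic.BSMLI Var) (TeamLogic.invariantPairs.{u} Var) ∧
      TeamLogic.BicompleteModuloExpressivePower (TeamLogic.BSML Var)
        (TeamLogic.groundIncompatiblePairs.{u} Var) ∧
      TeamLogic.BicompleteModuloExpressivePower (TeamLogic.BSMLI Var)
        (TeamLogic.groundIncompatiblePairs.{u} Var) :=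
  ⟨TeamLogic.bicomplete_BSML, TeamLogic.bicomplete_BSMLI,
    TeamLogic.bicompleteModuloExpressivePower_BSML,
    TeamLogic.bicompleteModuloExpressivePower_BSMLI⟩
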